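/- Let $q$ be a complex number with $0<|q|<1$. Write $(a;q)_\infty=\prod_{j\ge 0}(1-aq^j)$, $(a;q)_k=(a;q)_\infty/(aq^k;q)_\infty$ for $k\in\mathbb Z$, $(q)_k=(q;q)_k$ and $(a_1,a_2,a_3;p)_\infty=(a_1;p)_\infty(a_2;p)_\infty(a_3;p)_\infty$. For integers $N,j$ put $\left[{N\atop j}\right]=\frac{(q)_N}{(q)_j(q)_{N-j}}$ if $0\le j\le N$, and $\left[{N\atop j}\right]=0$ otherwise. Theorem 1.15 ($m$-version of the Andrews–Gordon identities). Let $m\ge 0$, $r\ge 2$ and $0\le i\le r$ be integers. Then $$\sum_{s_1\ge\dots\ge s_r\ge-\lfloor m/2\rfloor}\frac{q^{s_1^2+\dots+s_r^2+m(s_1+\dots+s_r)-s_1-\dots-s_i}}{(q)_{s_1-s_2}\cdots(q)_{s_{r-1}-s_r}}(-1)^{s_r}q^{\binom{s_r}{2}}\left[{m+s_r\atop m+2s_r}\right]=\sum_{k=0}^{i}q^{mk}\,\frac{\bigl(q^{2r+1},\,q^{(m+1)r-i+2k},\,q^{(1-m)r+i-2k+1};\,q^{2r+1}\bigr)_\infty}{(q)_\infty},$$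 where the sum is over integers $s_1,\dots,s_r$ and converges absolutely, and $\binom{s}{2}=s(s-1)/2$ for every integer $s$. -/

import Mathlib

/-- The infinite `q`-shifted factorial `(a; q)_∞ = ∏_{j ≥ 0} (1 - a q ^ j)`. -/
noncomputable def qPochInf (a q : ℂ) : ℂ :=
  ∏' j : ℕ, (1 - a * q ^ j)

/-- The `q`-shifted factorial `(a; q)_k = (a; q)_∞ / (a q ^ k; q)_∞` for an integer `k`. -/
noncomputable def qPoch (a q : ℂ) (k : ℤ) : ℂ :=
  qPochInf a q / qPochInf (a * q ^ k) q

/-- The `q`-binomial coefficient `(q)_N / ((q)_j (q)_{N - j})`, which is `0`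
unless `0 ≤ j ≤ N`. -/
noncomputable def qBinom (q : ℂ) (N j : ℤ) : ℂ :=
  if 0 ≤ j ∧ j ≤ N then qPoch q q N / (qPoch q q j * qPoch q q (N - j)) else 0

/-- The integer sequences `s_1 ≥ s_2 ≥ ⋯ ≥ s_r ≥ -⌊m / 2⌋`;
the entry `s_{j + 1}` is `s j` for `j : Fin r`. -/
def multiIndices (m r : ℕ) : Set (Fin r → ℤ) :=
  {s | Antitone s ∧ ∀ j, -((m / 2 : ℕ) : ℤ) ≤ s j}

/-- The exponent `s_1 ^ 2 + ⋯ + s_r ^ 2 + m (s_1 + ⋯ + s_r) - s_1 - ⋯ - s_i`. -/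
def sumExponent (m r i : ℕ) (s : Fin r → ℤ) : ℤ :=
  ∑ j, s j ^ 2 + (m : ℤ) * ∑ j, s j - ∑ j with j.val < i, s j

/-- The denominator `(q)_{s_1 - s_2} (q)_{s_2 - s_3} ⋯ (q)_{s_{r - 1} - s_r}`. -/
noncomputable def sumDenominator (q : ℂ) (r : ℕ) (s : Fin r → ℤ) : ℂ :=
  ∏ j : Fin (r - 1), qPoch q q (s ⟨j.val, by omega⟩ - s ⟨j.val + 1, by omega⟩)

/-- The factor `(-1) ^ t * q ^ (t (t - 1) / 2)` times the `q`-binomial coefficient of `m + t`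
over `m + 2 t`, for an integer `t`. The division in the exponent is exact. -/
noncomputable def lastFactor (q : ℂ) (m : ℕ) (t : ℤ) : ℂ :=
  (-1) ^ t * q ^ (t * (t - 1) / 2) * qBinom q (m + t) (m + 2 * t)

open Filter Topology

/-! ### Infinite `q`-shifted factorials -/

/-! The proof iterates a bilateral Bailey lattice. By the q-binomial theorem the last factor at `n`
is a sum over all integers ρ of (-1)^ρ q^(ρ(ρ-1)/2) times the kernel 1/((q)_{n-ρ} (q)_{m+n+ρ})
(`hasSum_lastFactor`). Summing the kernel against q^(s²+ms)/(q)_{n-s} reproduces it up to q^(ρ²+mρ),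
by q-Chu–Vandermonde. With the extra q^(-s), each step lengthens by one term a geometric sum in x =
q^(m+2ρ) (`hasSum_baileyKernel_succ`).

Put an extra variable n in front of s_1, with the factor 1/(q)_{n-s_1}. For fixed n all ρ-sums are
finite, and induction on r gives `hasSum_chainTerm`. As n → ∞ the kernel tends to (1 + x + ⋯ +
x^i)/(q)_∞², and each power x^k yields one Jacobi triple product in base q^(2r+1). Dominated
convergence justifies both limits. -/

theorem summable_norm_mul_pow {q : ℂ} (hq1 : ‖q‖ < 1) (a : ℂ) :
    Summable fun j : ℕ => ‖-(a * q ^ j)‖ := by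
  simpa [norm_mul, norm_pow] using
    (summable_geometric_of_lt_one (norm_nonneg q) hq1).mul_left ‖a‖

theorem multipliable_one_sub_mul_pow {q : ℂ} (hq1 : ‖q‖ < 1) (a : ℂ) :
    Multipliable fun j : ℕ => 1 - a * q ^ j := by
  simpa [sub_eq_add_neg] using multipliable_one_add_of_summable (summable_norm_mul_pow hq1 a)

theorem qPochInf_eq_mul {q : ℂ} (hq1 : ‖q‖ < 1) (a : ℂ) :
    qPochInf a q = (1 - a) * qPochInf (a * q) q := by
  have h := multipliable_one_sub_mul_pow hq1 (a * q)
  unfold qPochInf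
  rw [tprod_eq_zero_mul' (f := fun j : ℕ => 1 - a * q ^ j)
    (h.congr fun j => by simp [pow_succ', mul_assoc])]
  simp [pow_succ', mul_assoc]

theorem tendsto_prod_qPochInf {q : ℂ} (hq1 : ‖q‖ < 1) (a : ℂ) :
    Tendsto (fun n : ℕ => ∏ j ∈ Finset.range n, (1 - a * q ^ j)) atTop (𝓝 (qPochInf a q)) :=
  (multipliable_one_sub_mul_pow hq1 a).tendsto_prod_tprod_nat

theorem one_sub_pow_ne_zero {q : ℂ} (hq1 : ‖q‖ < 1) {n : ℕ} (hn : n ≠ 0) : 1 - q ^ n ≠ 0 := by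
  intro h
  have h1 : ‖q ^ n‖ = 1 := by rw [← sub_eq_zero.1 h]; simp
  rw [norm_pow] at h1
  exact (pow_lt_one₀ (norm_nonneg q) hq1 hn).ne h1

theorem qPochInf_self_ne_zero {q : ℂ} (hq1 : ‖q‖ < 1) : qPochInf q q ≠ 0 := by
  have h := tprod_one_add_ne_zero_of_summable (f := fun j : ℕ => -(q * q ^ j))
    (fun j => by
      rw [← sub_eq_add_neg, ← pow_succ']; exact one_sub_pow_ne_zero hq1 j.succ_ne_zero)
    (summable_norm_mul_pow hq1 q)
  simpa [qPochInf, sub_eq_add_neg] using h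

/-! ### Reciprocals of finite `q`-factorials -/

/-- The reciprocal `1 / (q; q)_k`, which vanishes for `k < 0`. -/
noncomputable def qFacInv (q : ℂ) (k : ℤ) : ℂ := (qPoch q q k)⁻¹

theorem qFacInv_zero {q : ℂ} (hq1 : ‖q‖ < 1) : qFacInv q 0 = 1 := by
  simp [qFacInv, qPoch, qPochInf_self_ne_zero hq1]

/-- Valid for every integer k: `inv_div` is unconditional, so the division by zero hidden in `qPoch`
at negative index becomes the correct reciprocal 0. -/
theorem qFacInv_sub_one {q : ℂ} (hq0 : q ≠ 0) (hq1 : ‖q‖ < 1) (k : ℤ) :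
    qFacInv q (k - 1) = (1 - q ^ k) * qFacInv q k := by
  have h1 : q * q ^ (k - 1) = q ^ k := by rw [← zpow_one_add₀ hq0]; congr 1; ring
  have h2 : q * q ^ k = q ^ k * q := mul_comm _ _
  rw [qFacInv, qFacInv, qPoch, qPoch, h1, h2, qPochInf_eq_mul hq1 (q ^ k), inv_div, inv_div,
    mul_div_assoc]

theorem qFacInv_of_neg {q : ℂ} (hq0 : q ≠ 0) (hq1 : ‖q‖ < 1) {k : ℤ} (hk : k < 0) :
    qFacInv q k = 0 := by
  have h : ∀ n : ℕ, qFacInv q (-(n : ℤ) - 1) = 0 := by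
    intro n
    induction n with
    | zero => rw [qFacInv_sub_one hq0 hq1]; simp
    | succ n ih =>
      rw [qFacInv_sub_one hq0 hq1, Nat.cast_succ, neg_add, ← sub_eq_add_neg, ih, mul_zero]
  obtain ⟨n, hn⟩ := Int.eq_ofNat_of_zero_le (show 0 ≤ -k - 1 by omega)
  have := h n
  rwa [show -(n : ℤ) - 1 = k by omega] at this

theorem qFacInv_natCast {q : ℂ} (hq0 : q ≠ 0) (hq1 : ‖q‖ < 1) (n : ℕ) :
    qFacInv q n = (∏ j ∈ Finset.range n, (1 - q * q ^ j))⁻¹ := by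
  induction n with
  | zero => simp [qFacInv_zero hq1]
  | succ n ih =>
    have h := qFacInv_sub_one hq0 hq1 ((n + 1 : ℕ) : ℤ)
    have h3 := one_sub_pow_ne_zero hq1 n.succ_ne_zero
    rw [show ((n + 1 : ℕ) : ℤ) - 1 = n by push_cast; ring, ih, zpow_natCast] at h
    rw [Finset.prod_range_succ, mul_inv, h, ← pow_succ']
    field_simp

theorem qFacInv_ne_zero {q : ℂ} (hq0 : q ≠ 0) (hq1 : ‖q‖ < 1) {k : ℤ} (hk : 0 ≤ k) :
    qFacInv q k ≠ 0 := by
  lift k to ℕ using hk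
  rw [qFacInv_natCast hq0 hq1]
  refine inv_ne_zero (Finset.prod_ne_zero_iff.2 fun j _ => ?_)
  rw [← pow_succ']
  exact one_sub_pow_ne_zero hq1 j.succ_ne_zero

theorem tendsto_qFacInv {q : ℂ} (hq0 : q ≠ 0) (hq1 : ‖q‖ < 1) (c : ℤ) :
    Tendsto (fun n : ℕ => qFacInv q (n + c)) atTop (𝓝 (qPochInf q q)⁻¹) := by
  have h : Tendsto (fun n : ℕ => qFacInv q n) atTop (𝓝 (qPochInf q q)⁻¹) := by
    simp_rw [qFacInv_natCast hq0 hq1]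
    exact (tendsto_prod_qPochInf hq1 q).inv₀ (qPochInf_self_ne_zero hq1)
  have hc : Tendsto (fun n : ℕ => ((n : ℤ) + c).toNat) atTop atTop :=
    tendsto_atTop.2 fun b => eventually_atTop.2 ⟨b + c.natAbs, fun n hn => by omega⟩
  refine (h.comp hc).congr' ?_
  filter_upwards [eventually_ge_atTop c.natAbs] with n hn
  simp only [Function.comp_apply]
  rw [Int.toNat_of_nonneg (by omega)]

theorem exists_norm_qFacInv_le {q : ℂ} (hq0 : q ≠ 0) (hq1 : ‖q‖ < 1) :
    ∃ C : ℝ, 1 ≤ C ∧ ∀ k : ℤ, ‖qFacInv q k‖ ≤ C := by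
  obtain ⟨C, hC⟩ := (tendsto_qFacInv hq0 hq1 0).norm.bddAbove_range
  refine ⟨max C 1, le_max_right _ _, fun k => ?_⟩
  rcases lt_or_ge k 0 with hk | hk
  · rw [qFacInv_of_neg hq0 hq1 hk, norm_zero]; positivity
  · lift k to ℕ using hk
    exact le_max_of_le_left (hC ⟨k, by simp⟩)

/-! ### Terminating sums over the integers -/

theorem HasSum.congr_eq {ι : Type*} {f g : ι → ℂ} {a b : ℂ} (hf : HasSum f a)
    (h : ∀ t, g t = f t) (hab : b = a) : HasSum g b := by
  rw [hab]
  exact hf.congr_fun h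

theorem summable_of_eq_zero_outside_Icc {f : ℤ → ℂ} (a b : ℤ) (hf : ∀ t, t < a ∨ b < t → f t = 0) :
    Summable f :=
  summable_of_ne_finset_zero (s := Finset.Icc a b) fun t ht =>
    hf t (by rw [Finset.mem_Icc] at ht; omega)

/-- Shifting the index of one part leaves the total unchanged; this turns a Pascal-type recursion of
summands into a recursion of sums. -/
theorem hasSum_of_split {f a b : ℤ → ℂ} {G : ℂ} (ha : Summable a)
    (h : HasSum (fun t => a t + b t) G) (hf : ∀ t, f t = a (t - 1) + b t) : HasSum f G := by
  have hb : Summable b := by simpa using h.summable.sub ha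
  have ha' : HasSum (fun t => a (t - 1)) (∑' t, a t) :=
    (Equiv.subRight (1 : ℤ)).hasSum_iff.2 ha.hasSum
  rw [h.unique (ha.hasSum.add hb.hasSum)]
  exact (ha'.add hb.hasSum).congr_fun hf

/-- The `q`-Chu–Vandermonde summation. -/
theorem hasSum_qVandermonde {q : ℂ} (hq0 : q ≠ 0) (hq1 : ‖q‖ < 1) (N M : ℤ) :
    HasSum (fun t : ℤ => q ^ (t ^ 2 + M * t) * (qFacInv q (N - t) * qFacInv q t * qFacInv q (M + t)))
      (qFacInv q N * qFacInv q (M + N)) := by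
  rcases lt_or_ge N 0 with hN | hN
  · rw [qFacInv_of_neg hq0 hq1 hN, zero_mul]
    convert hasSum_zero with t
    rcases lt_or_ge t 0 with ht | ht
    · simp [qFacInv_of_neg hq0 hq1 ht]
    · simp [qFacInv_of_neg hq0 hq1 (show N - t < 0 by omega)]
  lift N to ℕ using hN
  induction N generalizing M with
  | zero =>
    convert hasSum_single (0 : ℤ) fun t ht => ?_ using 1
    · simp [qFacInv_zero hq1]
    · rcases lt_or_gt_of_ne ht with ht | ht
      · simp [qFacInv_of_neg hq0 hq1 ht]
      · simp [qFacInv_of_neg hq0 hq1 (show -t < 0 by omega)]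
  | succ N ih =>
    have hne : (1 : ℂ) - q ^ ((N : ℤ) + 1) ≠ 0 := by
      exact_mod_cast one_sub_pow_ne_zero hq1 N.succ_ne_zero
    have hN1 := qFacInv_sub_one hq0 hq1 ((N : ℤ) + 1)
    rw [add_sub_cancel_right] at hN1
    push_cast
    rw [← hasSum_mul_left_iff hne]
    -- Write 1 - q^(N+1) = (1 - q^t) + q^t (1 - q^(N+1-t)). The two pieces are the summand for (N,
    -- M+1) at t-1 and at t, with weights q^(M+1+t) (taken at t-1) and 1 - q^(M+1+t).
    refine hasSum_of_split
      (a := fun t => q ^ (t ^ 2 + (M + 1) * t) *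
        (qFacInv q (N - t) * qFacInv q t * qFacInv q (M + 1 + t)) * q ^ (M + 1 + t))
      (b := fun t => q ^ (t ^ 2 + (M + 1) * t) *
        (qFacInv q (N - t) * qFacInv q t * qFacInv q (M + 1 + t)) * (1 - q ^ (M + 1 + t)))
      (summable_of_eq_zero_outside_Icc 0 N fun t ht => ?_) ?_ fun t => ?_
    · rcases ht with ht | ht
      · simp [qFacInv_of_neg hq0 hq1 ht]
      · simp [qFacInv_of_neg hq0 hq1 (show (N : ℤ) - t < 0 by omega)]
    · convert ih (M + 1) using 1
      · ext t; ring
      · rw [← mul_assoc, ← hN1]; congr 2; ring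
    · have h1 := qFacInv_sub_one hq0 hq1 t
      have h2 := qFacInv_sub_one hq0 hq1 (M + 1 + t)
      have h3 := qFacInv_sub_one hq0 hq1 ((N : ℤ) + 1 - t)
      have e1 : q ^ ((t - 1) ^ 2 + (M + 1) * (t - 1)) * q ^ (M + 1 + (t - 1)) =
          q ^ (t ^ 2 + M * t) := by rw [← zpow_add₀ hq0]; congr 1; ring
      have e2 : q ^ (t ^ 2 + (M + 1) * t) = q ^ (t ^ 2 + M * t) * q ^ t := by
        rw [← zpow_add₀ hq0]; congr 1; ring
      have e3 : q ^ ((N : ℤ) + 1) = q ^ ((N : ℤ) + 1 - t) * q ^ t := by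
        rw [← zpow_add₀ hq0]; congr 1; ring
      simp only [show (N : ℤ) - (t - 1) = N + 1 - t by ring, show M + 1 + (t - 1) = M + t by ring,
        show M + 1 + t - 1 = M + t by ring, show (N : ℤ) + 1 - t - 1 = N - t by ring] at *
      rw [h1, e2, h3, e3, h2]
      linear_combination (-(1 - q ^ t) * (1 - q ^ (M + 1 + t)) * qFacInv q (N + 1 - t) *
        qFacInv q t * qFacInv q (M + 1 + t)) * e1

/-- Split 1 = q^t + (1 - q^t). The second part turns 1/(q)_t into 1/(q)_{t-1}, giving a Vandermonde
sum for (N-1, M+1) shifted by one. -/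
theorem hasSum_qVandermonde_sub {q : ℂ} (hq0 : q ≠ 0) (hq1 : ‖q‖ < 1) (N M : ℤ) :
    HasSum (fun t : ℤ => q ^ (t ^ 2 + (M - 1) * t) *
        (qFacInv q (N - t) * qFacInv q t * qFacInv q (M + t)))
      (qFacInv q N * qFacInv q (M + N) * (1 + q ^ M * (1 - q ^ N))) := by
  have h1 := hasSum_qVandermonde hq0 hq1 N M
  have h2 := ((Equiv.subRight (1 : ℤ)).hasSum_iff.2
    (hasSum_qVandermonde hq0 hq1 (N - 1) (M + 1))).mul_left (q ^ M)
  convert h1.add h2 using 1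
  · ext t
    have h3 := qFacInv_sub_one hq0 hq1 t
    have e1 : q ^ (t ^ 2 + M * t) = q ^ (t ^ 2 + (M - 1) * t) * q ^ t := by
      rw [← zpow_add₀ hq0]; congr 1; ring
    have e2 : q ^ (t ^ 2 + (M - 1) * t) = q ^ M * q ^ ((t - 1) ^ 2 + (M + 1) * (t - 1)) := by
      rw [← zpow_add₀ hq0]; congr 1; ring
    simp only [Function.comp_apply, Equiv.subRight_apply, show N - 1 - (t - 1) = N - t by ring,
      show M + 1 + (t - 1) = M + t by ring]
    rw [h3, e1, ← mul_assoc (q ^ M), ← e2]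
    ring
  · rw [qFacInv_sub_one hq0 hq1, show M + 1 + (N - 1) = M + N by ring]
    ring

/-! ### The `q`-binomial theorem -/

theorem two_mul_triangle (j : ℤ) : 2 * (j * (j - 1) / 2) = j * (j - 1) :=
  Int.mul_ediv_cancel' (by
    rw [mul_comm]; simpa [add_comm] using (Int.even_mul_succ_self (j - 1)).two_dvd)

theorem triangle_sub_one (j : ℤ) : (j - 1) * (j - 1 - 1) / 2 = j * (j - 1) / 2 - (j - 1) := by
  have h1 := two_mul_triangle j
  have h2 := two_mul_triangle (j - 1)
  linarith

/-- The terminating `q`-binomial theorem. -/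
theorem hasSum_qBinomial {q : ℂ} (hq0 : q ≠ 0) (hq1 : ‖q‖ < 1) {z : ℂ} (hz : z ≠ 0) (N : ℕ) :
    HasSum (fun j : ℤ => (-1) ^ j * q ^ (j * (j - 1) / 2) * z ^ j *
        (qFacInv q j * qFacInv q (N - j)))
      (qFacInv q N * ∏ j ∈ Finset.range N, (1 - z * q ^ j)) := by
  induction N with
  | zero =>
    convert hasSum_single (0 : ℤ) fun t ht => ?_ using 1
    · simp [qFacInv_zero hq1]
    · rcases lt_or_gt_of_ne ht with ht | ht
      · simp [qFacInv_of_neg hq0 hq1 ht]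
      · simp [qFacInv_of_neg hq0 hq1 (show -t < 0 by omega)]
  | succ N ih =>
    have hne : (1 : ℂ) - q ^ ((N : ℤ) + 1) ≠ 0 := by
      exact_mod_cast one_sub_pow_ne_zero hq1 N.succ_ne_zero
    have hN1 := qFacInv_sub_one hq0 hq1 ((N : ℤ) + 1)
    rw [add_sub_cancel_right] at hN1
    push_cast
    rw [← hasSum_mul_left_iff hne]
    -- Together with `ih` this multiplies the sum by 1 - z q^N; termwise it is 1 - q^(N+1) = (1 -
    -- q^(N+1-j)) + q^(N+1-j) (1 - q^j).
    have hshift := ((Equiv.subRight (1 : ℤ)).hasSum_iff.2 ih).mul_left (-(z * q ^ N))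
    refine (ih.add hshift).congr_eq (fun j => ?_) ?_
    · have h1 := qFacInv_sub_one hq0 hq1 j
      have h3 := qFacInv_sub_one hq0 hq1 ((N : ℤ) + 1 - j)
      have e1 : (-1 : ℂ) ^ j = (-1) ^ (j - 1) * (-1) := by
        rw [← zpow_add_one₀ (by norm_num)]; congr 1; ring
      have e2 : z ^ j = z ^ (j - 1) * z := by
        rw [← zpow_add_one₀ hz]; congr 1; ring
      have e3 : q ^ (j * (j - 1) / 2) * q ^ ((N : ℤ) + 1 - j) =
          q ^ (j * (j - 1) / 2 - (j - 1)) * q ^ N := by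
        rw [← zpow_natCast q N, ← zpow_add₀ hq0, ← zpow_add₀ hq0]; congr 1; ring
      have e4 : q ^ ((N : ℤ) + 1) = q ^ ((N : ℤ) + 1 - j) * q ^ j := by
        rw [← zpow_add₀ hq0]; congr 1; ring
      simp only [Function.comp_apply, Equiv.subRight_apply, triangle_sub_one,
        show (N : ℤ) - (j - 1) = N + 1 - j by ring,
        show (N : ℤ) + 1 - j - 1 = N - j by ring] at *
      rw [h1, h3, e1, e2, e4]
      linear_combination ((-1) ^ (j - 1) * (-1) * (z ^ (j - 1) * z) * (1 - q ^ j) *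
        (qFacInv q j * qFacInv q (N + 1 - j))) * e3
    · rw [Finset.prod_range_succ, hN1]
      ring

/-! ### Summability of theta-like series -/

theorem summable_norm_zpow_of_abs_le {q : ℂ} (hq0 : q ≠ 0) (hq1 : ‖q‖ < 1) {E : ℤ → ℤ} (c : ℤ)
    (hE : ∀ n, |n| ≤ E n + c) : Summable fun n : ℤ => ‖q ^ E n‖ := by
  have hpos : 0 < ‖q‖ := norm_pos_iff.2 hq0
  have hs : Summable fun n : ℤ => ‖q‖ ^ |n| := by
    have hg := summable_geometric_of_lt_one (norm_nonneg q) hq1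
    rw [summable_int_iff_summable_nat_and_neg]
    exact ⟨hg.congr fun n => by simp, hg.congr fun n => by simp⟩
  refine (hs.mul_left (‖q‖ ^ (-c))).of_nonneg_of_le (fun n => norm_nonneg _) fun n => ?_
  rw [norm_zpow, ← zpow_add₀ hpos.ne']
  exact zpow_le_zpow_right_of_le_one₀ hpos hq1.le (by linarith [hE n])

theorem summable_norm_zpow_quadratic {q : ℂ} (hq0 : q ≠ 0) (hq1 : ‖q‖ < 1) {E : ℤ → ℤ} (b c : ℤ)
    (hE : ∀ n, n ^ 2 ≤ 2 * E n + b * |n| + c) : Summable fun n : ℤ => ‖q ^ E n‖ := by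
  -- The constant comes from completing the square in |n|² - (b+2)|n|.
  refine summable_norm_zpow_of_abs_le hq0 hq1 (|c| + (b + 2) ^ 2) fun n => ?_
  have h1 := hE n
  have h2 : n ^ 2 = |n| ^ 2 := (sq_abs n).symm
  nlinarith [sq_nonneg (2 * |n| - (b + 2)), le_abs_self c, abs_nonneg c, sq_nonneg (b + 2)]

/-- Both ‖z‖ and ‖z‖⁻¹ are at most ‖q‖^(-k) for some k, so z^n costs only -k|n| in the exponent,
which the quadratic term absorbs. -/
theorem summable_norm_theta {q z : ℂ} (hq0 : q ≠ 0) (hq1 : ‖q‖ < 1) (hz : z ≠ 0) :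
    Summable fun n : ℤ => ‖q ^ (n * (n - 1) / 2) * z ^ n‖ := by
  have hpos : 0 < ‖q‖ := norm_pos_iff.2 hq0
  have hzpos : 0 < ‖z‖ := norm_pos_iff.2 hz
  obtain ⟨k, hk⟩ := exists_pow_lt_of_lt_one (lt_min hzpos (inv_pos.2 hzpos)) hq1
  have hk1 : ‖z‖⁻¹ ≤ ‖q‖ ^ (-(k : ℤ)) := by
    rw [zpow_neg, zpow_natCast]
    exact inv_anti₀ (by positivity) (hk.le.trans (min_le_left _ _))
  have hk2 : ‖z‖ ≤ ‖q‖ ^ (-(k : ℤ)) := by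
    rw [zpow_neg, zpow_natCast, ← inv_inv ‖z‖]
    exact inv_anti₀ (by positivity) (hk.le.trans (min_le_right _ _))
  have hzn : ∀ n : ℤ, ‖z‖ ^ n ≤ ‖q‖ ^ (-(k : ℤ) * |n|) := by
    intro n
    rcases le_total 0 n with hn | hn
    · rw [abs_of_nonneg hn]
      lift n to ℕ using hn
      rw [zpow_mul, zpow_natCast, zpow_natCast]
      exact pow_le_pow_left₀ hzpos.le hk2 n
    · rw [abs_of_nonpos hn]
      obtain ⟨l, rfl⟩ : ∃ l : ℕ, n = -(l : ℤ) := ⟨n.natAbs, by omega⟩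
      rw [neg_neg, zpow_mul, zpow_neg, zpow_natCast, zpow_natCast, ← inv_pow]
      exact pow_le_pow_left₀ (inv_nonneg.2 hzpos.le) hk1 l
  refine (summable_norm_zpow_quadratic hq0 hq1 (E := fun n => n * (n - 1) / 2 + -(k : ℤ) * |n|)
    (2 * k + 1) 0 fun n => ?_).of_nonneg_of_le (fun n => norm_nonneg _) fun n => ?_
  · linarith [two_mul_triangle n, le_abs_self n]
  · rw [norm_mul, norm_zpow, norm_zpow, norm_zpow, zpow_add₀ hpos.ne']
    exact mul_le_mul_of_nonneg_left (hzn n) (by positivity)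

/-! ### The Jacobi triple product -/

theorem prod_neg_mul_inv_pow {q z : ℂ} (hq0 : q ≠ 0) (K : ℕ) :
    ∏ j ∈ Finset.range K, (-(z / q ^ (j + 1))) =
      (-1) ^ K * z ^ K * q ^ (-((K : ℤ) * (K + 1) / 2)) := by
  induction K with
  | zero => simp
  | succ K ih =>
    have h1 := two_mul_triangle ((K : ℤ) + 1)
    have h2 := two_mul_triangle ((K : ℤ) + 2)
    have e : q ^ (-((K : ℤ) * (K + 1) / 2)) =
        q ^ (-(((K + 1 : ℕ) : ℤ) * ((K + 1 : ℕ) + 1) / 2)) * q ^ (K + 1) := by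
      rw [← zpow_natCast, ← zpow_add₀ hq0]
      congr 1
      push_cast
      rw [show ((K : ℤ) + 1) * (K + 1 - 1) = K * (K + 1) by ring] at h1
      rw [show ((K : ℤ) + 2) * (K + 2 - 1) = (K + 1) * (K + 1 + 1) by ring] at h2
      linarith
    rw [Finset.prod_range_succ, ih, e]
    field_simp
    ring

/-- In the lower half, 1 - z/q^(j+1) = -(z/q^(j+1)) (1 - q^(j+1)/z), which brings out the factors in
q/z. -/
theorem prod_range_two_mul_shift {q z : ℂ} (hq0 : q ≠ 0) (hz : z ≠ 0) (K : ℕ) :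
    ∏ j ∈ Finset.range (2 * K), (1 - z * q ^ (-(K : ℤ)) * q ^ j) =
      (-1) ^ K * z ^ K * q ^ (-((K : ℤ) * (K + 1) / 2)) *
        ((∏ j ∈ Finset.range K, (1 - z * q ^ j)) *
          ∏ j ∈ Finset.range K, (1 - q / z * q ^ j)) := by
  rw [two_mul, Finset.prod_range_add,
    ← Finset.prod_range_reflect (fun j => 1 - z * q ^ (-(K : ℤ)) * q ^ j), ← prod_neg_mul_inv_pow hq0,
    mul_left_comm, mul_comm]
  congr 1
  · refine Finset.prod_congr rfl fun j _ => ?_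
    rw [mul_assoc, zpow_neg, zpow_natCast, pow_add, inv_mul_cancel_left₀ (pow_ne_zero _ hq0)]
  · rw [← Finset.prod_mul_distrib]
    refine Finset.prod_congr rfl fun j hj => ?_
    have hj' := Finset.mem_range.1 hj
    have e : q ^ (-(K : ℤ)) * q ^ (K - 1 - j) = (q ^ (j + 1))⁻¹ := by
      rw [← zpow_natCast, ← zpow_natCast, ← zpow_neg, ← zpow_add₀ hq0]
      congr 1
      omega
    rw [mul_assoc, e]
    field_simp
    ring

/-- The finite form of the Jacobi triple product identity. -/
theorem hasSum_finite_tripleProduct {q z : ℂ} (hq0 : q ≠ 0) (hq1 : ‖q‖ < 1) (hz : z ≠ 0) (K : ℕ) :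
    HasSum (fun n : ℤ => (-1) ^ n * (q ^ (n * (n - 1) / 2) * z ^ n) *
        (qFacInv q (K + n) * qFacInv q (K - n)))
      (qFacInv q (2 * K) * ((∏ j ∈ Finset.range K, (1 - z * q ^ j)) *
          ∏ j ∈ Finset.range K, (1 - q / z * q ^ j))) := by
  have hD : (-1 : ℂ) ^ K * z ^ K * q ^ (-((K : ℤ) * (K + 1) / 2)) ≠ 0 :=
    mul_ne_zero (mul_ne_zero (pow_ne_zero _ (by norm_num)) (pow_ne_zero _ hz)) (zpow_ne_zero _ hq0)
  -- The q-binomial theorem of order 2K at z q^(-K), recentred by j = K + n.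
  have h := (Equiv.addLeft (K : ℤ)).hasSum_iff.2
    (hasSum_qBinomial hq0 hq1 (mul_ne_zero hz (zpow_ne_zero (-(K : ℤ)) hq0)) (2 * K))
  rw [prod_range_two_mul_shift hq0 hz, mul_left_comm] at h
  rw [← hasSum_mul_left_iff hD]
  refine h.congr_eq (fun n => ?_) (by push_cast; rfl)
  have h1 := two_mul_triangle n
  have h2 := two_mul_triangle ((K : ℤ) + n)
  have h3 := two_mul_triangle ((K : ℤ) + 1)
  rw [show ((K : ℤ) + 1) * (K + 1 - 1) = K * (K + 1) by ring] at h3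
  have e1 : q ^ (-((K : ℤ) * (K + 1) / 2)) * q ^ (n * (n - 1) / 2) =
      q ^ (((K : ℤ) + n) * (K + n - 1) / 2) * q ^ (-(K : ℤ) * (K + n)) := by
    rw [← zpow_add₀ hq0, ← zpow_add₀ hq0]
    congr 1
    linarith
  simp only [Function.comp_apply, Equiv.coe_addLeft, mul_zpow, ← zpow_mul]
  rw [zpow_add₀ hz, zpow_add₀ (show (-1 : ℂ) ≠ 0 by norm_num),
    show ((2 * K : ℕ) : ℤ) - (K + n) = K - n by push_cast; ring]
  simp only [zpow_natCast]
  linear_combination ((-1) ^ K * (-1) ^ n * z ^ K * z ^ n *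
    (qFacInv q (K + n) * qFacInv q (K - n))) * e1

theorem hasSum_of_tendsto_dominated {ι : Type*} {F : ℕ → ι → ℂ} {f : ι → ℂ} {bound : ι → ℝ}
    {S : ℕ → ℂ} {L : ℂ} (hbound : Summable bound) (hF : ∀ n k, ‖F n k‖ ≤ bound k)
    (hlim : ∀ k, Tendsto (fun n => F n k) atTop (𝓝 (f k))) (hS : ∀ n, HasSum (F n) (S n))
    (hL : Tendsto S atTop (𝓝 L)) : HasSum f L := by
  have h := tendsto_tsum_of_dominated_convergence hbound hlim (Eventually.of_forall hF)
  simp_rw [fun n => (hS n).tsum_eq] at h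
  have hf : Summable f := hbound.of_norm_bounded fun k =>
    le_of_tendsto (hlim k).norm (Eventually.of_forall fun n => hF n k)
  rw [tendsto_nhds_unique hL h]
  exact hf.hasSum

/-- The Jacobi triple product identity. -/
theorem hasSum_tripleProduct {q z : ℂ} (hq0 : q ≠ 0) (hq1 : ‖q‖ < 1) (hz : z ≠ 0) :
    HasSum (fun n : ℤ => (-1) ^ n * (q ^ (n * (n - 1) / 2) * z ^ n))
      (qPochInf q q * qPochInf z q * qPochInf (q / z) q) := by
  obtain ⟨C, hC1, hC⟩ := exists_norm_qFacInv_le hq0 hq1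
  have hne := qPochInf_self_ne_zero hq1
  have hlim2 : Tendsto (fun K : ℕ => qFacInv q (2 * K)) atTop (𝓝 (qPochInf q q)⁻¹) := by
    refine ((tendsto_qFacInv hq0 hq1 0).comp
      (tendsto_id.const_mul_atTop' (show 0 < 2 by norm_num))).congr fun K => ?_
    simp
  rw [← hasSum_mul_left_iff (mul_ne_zero (inv_ne_zero hne) (inv_ne_zero hne))]
  have hL := hlim2.mul ((tendsto_prod_qPochInf hq1 z).mul (tendsto_prod_qPochInf hq1 (q / z)))
  refine (hasSum_of_tendsto_dominated ((summable_norm_theta hq0 hq1 hz).mul_right (C * C))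
    (fun K n => ?_) (fun n => ?_) (hasSum_finite_tripleProduct hq0 hq1 hz) hL).congr_eq
      (fun n => mul_comm _ _) ?_
  · rw [norm_mul, norm_mul, norm_zpow, norm_neg, norm_one, one_zpow, one_mul, norm_mul (qFacInv _ _)]
    gcongr
    exacts [hC _, hC _]
  · refine Tendsto.const_mul _ ((tendsto_qFacInv hq0 hq1 n).mul ?_)
    simpa [sub_eq_add_neg] using tendsto_qFacInv hq0 hq1 (-n)
  · field_simp

/-! ### The last factor as a Bailey transform -/

theorem qFacInv_eq_mul_prod {q : ℂ} (hq0 : q ≠ 0) (hq1 : ‖q‖ < 1) (l : ℤ) (N : ℕ) :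
    qFacInv q l = qFacInv q (l + N) * ∏ j ∈ Finset.range N, (1 - q ^ (1 + l) * q ^ j) := by
  induction N with
  | zero => simp
  | succ N ih =>
    have h := qFacInv_sub_one hq0 hq1 (l + (N + 1 : ℕ))
    have e : q ^ (l + (N + 1 : ℕ)) = q ^ (1 + l) * q ^ N := by
      rw [← zpow_natCast, ← zpow_add₀ hq0]; congr 1; push_cast; ring
    rw [show l + ((N + 1 : ℕ) : ℤ) - 1 = l + N by push_cast; ring, e] at h
    rw [Finset.prod_range_succ, ih, h]
    ring

theorem qPoch_eq_inv (q : ℂ) (k : ℤ) : qPoch q q k = (qFacInv q k)⁻¹ := by simp [qFacInv]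

theorem lastFactor_eq_zero (q : ℂ) (m : ℕ) {t : ℤ} (ht : (m : ℤ) + 2 * t < 0 ∨ 0 < t) :
    lastFactor q m t = 0 := by
  rw [lastFactor, qBinom, if_neg (by omega), mul_zero]

/-- This is the q-binomial theorem of order m + 2n at z = q^(1-n), with j = n - ρ. -/
theorem hasSum_lastFactor {q : ℂ} (hq0 : q ≠ 0) (hq1 : ‖q‖ < 1) (m : ℕ) (n : ℤ) :
    HasSum (fun ρ : ℤ => (-1) ^ ρ * q ^ (ρ * (ρ - 1) / 2) *
      (qFacInv q (n - ρ) * qFacInv q (m + n + ρ))) (lastFactor q m n) := by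
  rcases lt_or_ge ((m : ℤ) + 2 * n) 0 with hN | hN
  · rw [lastFactor_eq_zero q m (Or.inl hN)]
    convert hasSum_zero with ρ
    rcases lt_or_ge (n - ρ) 0 with h | h
    · simp [qFacInv_of_neg hq0 hq1 h]
    · simp [qFacInv_of_neg hq0 hq1 (show m + n + ρ < 0 by omega)]
  obtain ⟨N, hN⟩ := Int.eq_ofNat_of_zero_le hN
  have h := ((Equiv.subLeft n).hasSum_iff.2
    (hasSum_qBinomial hq0 hq1 (zpow_ne_zero (1 - n) hq0) N)).mul_left
      ((-1) ^ n * q ^ (n * (n - 1) / 2))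
  refine h.congr_eq (fun ρ => ?_) ?_
  · have h1 := two_mul_triangle n
    have h2 := two_mul_triangle ρ
    have h3 := two_mul_triangle (n - ρ)
    have e1 : q ^ (ρ * (ρ - 1) / 2) = q ^ (n * (n - 1) / 2) *
        q ^ ((n - ρ) * (n - ρ - 1) / 2) * q ^ ((1 - n) * (n - ρ)) := by
      rw [← zpow_add₀ hq0, ← zpow_add₀ hq0]
      congr 1
      linarith
    have e2 : (-1 : ℂ) ^ ρ = (-1) ^ n * (-1) ^ (n - ρ) := by
      rw [← zpow_add₀ (by norm_num), show n + (n - ρ) = 2 * n + -ρ by ring,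
        zpow_add₀ (by norm_num), zpow_mul, zpow_neg, ← inv_zpow]
      norm_num
    simp only [Function.comp_apply, Equiv.subLeft_apply, ← zpow_mul]
    rw [e1, e2, show (N : ℤ) - (n - ρ) = m + n + ρ by omega]
    ring
  -- For n > 0 the product contains 1 - q^0; for n ≤ 0 it equals (q)_{m+n}/(q)_{-n}.
  · rcases lt_or_ge 0 n with hn | hn
    · rw [lastFactor_eq_zero q m (Or.inr hn),
        Finset.prod_eq_zero (i := (n - 1).toNat) (Finset.mem_range.2 (by omega)), mul_zero, mul_zero]
      rw [← zpow_natCast q, Int.toNat_of_nonneg (by omega), ← zpow_add₀ hq0]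
      simp
    · have h1 := qFacInv_eq_mul_prod hq0 hq1 (-n) N
      rw [show -n + (N : ℤ) = m + n by omega, ← sub_eq_add_neg] at h1
      have h2 := qFacInv_ne_zero hq0 hq1 (show 0 ≤ (m : ℤ) + n by omega)
      rw [lastFactor, qBinom, if_pos (by omega), qPoch_eq_inv, qPoch_eq_inv, qPoch_eq_inv,
        show (m : ℤ) + n - (m + 2 * n) = -n by ring, h1, hN]
      field_simp

/-! ### Bailey lattice kernels -/

/-- The kernel of the bilateral Bailey transform relative to `q ^ m`, after `i` steps of the Bailey
lattice relative to `q ^ (m - 1)`. -/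
noncomputable def baileyKernel (q : ℂ) (m i : ℕ) (ρ n : ℤ) : ℂ :=
  qFacInv q (n - ρ) * qFacInv q (m + n + ρ) *
    (1 + (∑ k ∈ Finset.range i, (q ^ ((m : ℤ) + 2 * ρ)) ^ (k + 1)) * (1 - q ^ (n - ρ)))

theorem baileyKernel_eq_zero {q : ℂ} (hq0 : q ≠ 0) (hq1 : ‖q‖ < 1) (m i : ℕ) {ρ n : ℤ}
    (h : n < ρ ∨ m + n + ρ < 0) : baileyKernel q m i ρ n = 0 := by
  rcases h with h | h
  · simp [baileyKernel, qFacInv_of_neg hq0 hq1 (show n - ρ < 0 by omega)]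
  · simp [baileyKernel, qFacInv_of_neg hq0 hq1 h]

/-- Put s = ρ + t: then s² + ms = ρ² + mρ + t² + (m+2ρ)t, and q-Chu–Vandermonde applies with
parameters n - ρ and m + 2ρ. -/
theorem hasSum_baileyKernel_zero {q : ℂ} (hq0 : q ≠ 0) (hq1 : ‖q‖ < 1) (m : ℕ) (ρ n : ℤ) :
    HasSum (fun s : ℤ => qFacInv q (n - s) * q ^ (s ^ 2 + m * s) * baileyKernel q m 0 ρ s)
      (q ^ (ρ ^ 2 + m * ρ) * baileyKernel q m 0 ρ n) := by
  have h := ((Equiv.subRight ρ).hasSum_iff.2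
    (hasSum_qVandermonde hq0 hq1 (n - ρ) (m + 2 * ρ))).mul_left (q ^ (ρ ^ 2 + m * ρ))
  refine h.congr_eq (fun s => ?_) ?_
  · have e : q ^ (s ^ 2 + m * s) =
        q ^ (ρ ^ 2 + m * ρ) * q ^ ((s - ρ) ^ 2 + (m + 2 * ρ) * (s - ρ)) := by
      rw [← zpow_add₀ hq0]; congr 1; ring
    simp only [Function.comp_apply, Equiv.subRight_apply, baileyKernel]
    rw [e, show n - ρ - (s - ρ) = n - s by ring, show (m : ℤ) + 2 * ρ + (s - ρ) = m + s + ρ by ring]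
    simp
    ring
  · rw [show (m : ℤ) + 2 * ρ + (n - ρ) = m + n + ρ by ring]
    simp [baileyKernel]

/-- Let x = q^(m+2ρ) and S = x + ⋯ + x^i. The term 1 becomes 1 + x(1 - q^(n-ρ)). In the other term 1
- q^(s-ρ) lowers (q)_{s-ρ}, and a shifted Vandermonde sum returns xS(1 - q^(n-ρ)). Thus S is
replaced by x + xS. -/
theorem hasSum_baileyKernel_succ {q : ℂ} (hq0 : q ≠ 0) (hq1 : ‖q‖ < 1) (m i : ℕ) (ρ n : ℤ) :
    HasSum (fun s : ℤ => qFacInv q (n - s) * q ^ (s ^ 2 + m * s - s) * baileyKernel q m i ρ s)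
      (q ^ (ρ ^ 2 + m * ρ - ρ) * baileyKernel q m (i + 1) ρ n) := by
  have h1 := ((Equiv.subRight ρ).hasSum_iff.2
    (hasSum_qVandermonde_sub hq0 hq1 (n - ρ) (m + 2 * ρ))).mul_left (q ^ (ρ ^ 2 + m * ρ - ρ))
  have h2 := ((Equiv.subRight (ρ + 1)).hasSum_iff.2
    (hasSum_qVandermonde hq0 hq1 (n - ρ - 1) (m + 2 * ρ + 1))).mul_left
      (q ^ (ρ ^ 2 + m * ρ - ρ) * q ^ (m + 2 * ρ) *
        ∑ k ∈ Finset.range i, (q ^ ((m : ℤ) + 2 * ρ)) ^ (k + 1))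
  refine (h1.add h2).congr_eq (fun s => ?_) ?_
  · have e1 : q ^ (s ^ 2 + m * s - s) =
        q ^ (ρ ^ 2 + m * ρ - ρ) * q ^ ((s - ρ) ^ 2 + (m + 2 * ρ - 1) * (s - ρ)) := by
      rw [← zpow_add₀ hq0]; congr 1; ring
    have e2 : q ^ ((s - ρ) ^ 2 + (m + 2 * ρ - 1) * (s - ρ)) = q ^ (m + 2 * ρ) *
        q ^ ((s - (ρ + 1)) ^ 2 + (m + 2 * ρ + 1) * (s - (ρ + 1))) := by
      rw [← zpow_add₀ hq0]; congr 1; ring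
    have h3 := qFacInv_sub_one hq0 hq1 (s - ρ)
    simp only [Function.comp_apply, Equiv.subRight_apply, baileyKernel]
    rw [e1, show n - ρ - (s - ρ) = n - s by ring, show (m : ℤ) + 2 * ρ + (s - ρ) = m + s + ρ by ring,
      show n - ρ - 1 - (s - (ρ + 1)) = n - s by ring,
      show (m : ℤ) + 2 * ρ + 1 + (s - (ρ + 1)) = m + s + ρ by ring,
      show s - (ρ + 1) = s - ρ - 1 by ring, h3]
    rw [show s - (ρ + 1) = s - ρ - 1 by ring] at e2
    rw [e2]
    ring
  · rw [show (m : ℤ) + 2 * ρ + (n - ρ) = m + n + ρ by ring,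
      show (m : ℤ) + 2 * ρ + 1 + (n - ρ - 1) = m + n + ρ by ring, qFacInv_sub_one hq0 hq1,
      baileyKernel, Finset.sum_range_succ']
    simp only [pow_succ', ← Finset.mul_sum]
    ring

/-! ### Sums over chains -/

theorem summable_pi_prod {r : ℕ} (f : Fin r → ℤ → ℝ) (hf0 : ∀ j n, 0 ≤ f j n)
    (hf : ∀ j, Summable (f j)) : Summable fun s : Fin r → ℤ => ∏ j, f j (s j) := by
  induction r with
  | zero => exact (hasSum_fintype _).summable
  | succ r ih =>
    rw [← (Fin.consEquiv fun _ => ℤ).summable_iff]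
    have h := (hf 0).mul_of_nonneg (ih (fun j => f j.succ) (fun j => hf0 _) fun j => hf _) (hf0 0)
      fun s => Finset.prod_nonneg fun j _ => hf0 _ _
    exact h.congr fun x => by simp [Fin.consEquiv, Fin.prod_univ_succ]

/-- The summand attached to a chain `t_0 ≥ t_1 ≥ ⋯ ≥ t_r`, including the factor
`1 / (q)_{t_0 - t_1}`. -/
noncomputable def chainTerm (q : ℂ) (m i : ℕ) {r : ℕ} (t : Fin (r + 1) → ℤ) : ℂ :=
  (∏ j : Fin r, qFacInv q (t j.castSucc - t j.succ) *
    q ^ (t j.succ ^ 2 + m * t j.succ - if j.val < i then t j.succ else 0)) *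
      lastFactor q m (t (Fin.last r))

theorem exists_norm_lastFactor_le (q : ℂ) (m : ℕ) : ∃ C : ℝ, 0 ≤ C ∧ ∀ t, ‖lastFactor q m t‖ ≤ C := by
  refine ⟨∑ t ∈ Finset.Icc (-(m : ℤ)) 0, ‖lastFactor q m t‖,
    Finset.sum_nonneg fun _ _ => norm_nonneg _, fun t => ?_⟩
  by_cases ht : t ∈ Finset.Icc (-(m : ℤ)) 0
  · exact Finset.single_le_sum (f := fun t => ‖lastFactor q m t‖) (fun _ _ => norm_nonneg _) ht
  · rw [Finset.mem_Icc] at ht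
    rw [lastFactor_eq_zero q m (by omega), norm_zero]
    exact Finset.sum_nonneg fun _ _ => norm_nonneg _

/-- The bound must not depend on n, so that it also dominates the limit n → ∞. Once the bounded
factors are replaced by constants, the coordinates separate. -/
theorem exists_summable_bound_chainTerm {q : ℂ} (hq0 : q ≠ 0) (hq1 : ‖q‖ < 1) (m i r : ℕ) :
    ∃ bound : (Fin r → ℤ) → ℝ, Summable bound ∧
      ∀ (n : ℤ) (s : Fin r → ℤ), ‖chainTerm q m i (Fin.cons n s : Fin (r + 1) → ℤ)‖ ≤ bound s := by
  obtain ⟨C, hC1, hC⟩ := exists_norm_qFacInv_le hq0 hq1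
  obtain ⟨D, hD0, hD⟩ := exists_norm_lastFactor_le q m
  refine ⟨fun s => (∏ j : Fin r,
    C * ‖q ^ (s j ^ 2 + m * s j - if j.val < i then s j else 0)‖) * D, ?_, fun n s => ?_⟩
  · refine (summable_pi_prod
      (fun j a => C * ‖q ^ (a ^ 2 + m * a - if j.val < i then a else 0)‖) (fun j a => by positivity)
      fun j => Summable.mul_left C ?_).mul_right D
    refine summable_norm_zpow_quadratic hq0 hq1 (2 * m + 2) 0 fun n => ?_
    have h1 := neg_abs_le n
    have h2 := le_abs_self n
    have h3 : 0 ≤ (m : ℤ) * (|n| + n) := mul_nonneg (by positivity) (by linarith)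
    split_ifs <;> nlinarith [sq_nonneg n]
  · rw [chainTerm, norm_mul, norm_prod]
    simp only [Fin.cons_succ, norm_mul]
    gcongr
    exacts [hC _, hD _]

theorem chainTerm_cons_cons (q : ℂ) (m i : ℕ) {r : ℕ} (n a : ℤ) (s : Fin r → ℤ) :
    chainTerm q m i (Fin.cons n (Fin.cons a s : Fin (r + 1) → ℤ) : Fin (r + 2) → ℤ) =
      qFacInv q (n - a) * q ^ (a ^ 2 + m * a - if 0 < i then a else 0) *
        chainTerm q m (i - 1) (Fin.cons a s : Fin (r + 1) → ℤ) := by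
  have h : ∀ j : Fin r, (j.val + 1 < i) = (j.val < i - 1) := fun j => by
    apply propext; omega
  rw [chainTerm, chainTerm, Fin.prod_univ_succ]
  simp only [Fin.cons_succ, Fin.castSucc_zero, Fin.cons_zero, Fin.val_zero, Fin.val_succ,
    ← Fin.succ_castSucc, ← Fin.succ_last, h]
  ring

theorem HasSum.of_chain_fibers {q : ℂ} (hq0 : q ≠ 0) (hq1 : ‖q‖ < 1) (m i : ℕ) {r : ℕ} (n : ℤ)
    {V : ℤ → ℂ} {T : ℂ}
    (hV : ∀ a, HasSum (fun s : Fin r → ℤ =>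
      chainTerm q m (i - 1) (Fin.cons a s : Fin (r + 1) → ℤ)) (V a))
    (hT : HasSum (fun a : ℤ =>
      qFacInv q (n - a) * q ^ (a ^ 2 + m * a - if 0 < i then a else 0) * V a) T) :
    HasSum (fun s : Fin (r + 1) → ℤ => chainTerm q m i (Fin.cons n s : Fin (r + 2) → ℤ)) T := by
  obtain ⟨bound, hb, hle⟩ := exists_summable_bound_chainTerm hq0 hq1 m i (r + 1)
  have hs : Summable fun s : Fin (r + 1) → ℤ =>
      chainTerm q m i (Fin.cons n s : Fin (r + 2) → ℤ) := hb.of_norm_bounded (hle n)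
  have h1 := (Fin.consEquiv fun _ => ℤ).hasSum_iff.2 hs.hasSum
  have h2 := h1.prod_fiberwise fun a => ((hV a).mul_left
    (qFacInv q (n - a) * q ^ (a ^ 2 + m * a - if 0 < i then a else 0))).congr_fun fun s => by
      rw [← chainTerm_cons_cons]; rfl
  rw [← h2.unique hT]
  exact hs.hasSum

/-- The coefficients of the bilateral Bailey pair after `r` steps, `i` of which are relative to
`q ^ (m - 1)`. -/
noncomputable def baileyCoeff (q : ℂ) (m r i : ℕ) (ρ : ℤ) : ℂ :=
  (-1) ^ ρ * q ^ (ρ * (ρ - 1) / 2 + r * ρ ^ 2 + ((r : ℤ) * m - i) * ρ)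

theorem baileyCoeff_succ_zero {q : ℂ} (hq0 : q ≠ 0) (m r : ℕ) (ρ : ℤ) :
    baileyCoeff q m (r + 1) 0 ρ = baileyCoeff q m r 0 ρ * q ^ (ρ ^ 2 + m * ρ) := by
  rw [baileyCoeff, baileyCoeff, mul_assoc, ← zpow_add₀ hq0]
  congr 2
  push_cast
  ring

theorem baileyCoeff_succ_succ {q : ℂ} (hq0 : q ≠ 0) (m r i : ℕ) (ρ : ℤ) :
    baileyCoeff q m (r + 1) (i + 1) ρ = baileyCoeff q m r i ρ * q ^ (ρ ^ 2 + m * ρ - ρ) := by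
  rw [baileyCoeff, baileyCoeff, mul_assoc, ← zpow_add₀ hq0]
  congr 2
  push_cast
  ring

theorem summable_baileyKernel {q : ℂ} (hq0 : q ≠ 0) (hq1 : ‖q‖ < 1) (m i : ℕ) (c : ℤ → ℂ) (n : ℤ) :
    Summable fun ρ => c ρ * baileyKernel q m i ρ n :=
  summable_of_eq_zero_outside_Icc (-m - n) n fun ρ hρ => by
    rw [baileyKernel_eq_zero hq0 hq1 m i (by omega), mul_zero]

/-- A termwise summation of kernels sums any series of kernels. -/
theorem hasSum_tsum_baileyKernel {q : ℂ} (hq0 : q ≠ 0) (hq1 : ‖q‖ < 1) (m i : ℕ) (c w K : ℤ → ℂ)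
    (n : ℤ) (h : ∀ ρ, HasSum (fun s => qFacInv q (n - s) * w s * baileyKernel q m i ρ s) (K ρ)) :
    HasSum (fun s => qFacInv q (n - s) * w s * ∑' ρ, c ρ * baileyKernel q m i ρ s)
      (∑' ρ, c ρ * K ρ) := by
  have hs : Summable fun x : ℤ × ℤ =>
      qFacInv q (n - x.1) * w x.1 * (c x.2 * baileyKernel q m i x.2 x.1) := by
    -- A nonzero term needs s ≤ n and -m - s ≤ ρ ≤ s, which confines both s and ρ to [-m-n, n]; the
    -- order of summation is then free.
    refine summable_of_ne_finset_zero
      (s := Finset.Icc (-m - n) n ×ˢ Finset.Icc (-m - n) n) fun x hx => ?_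
    simp only [Finset.mem_product, Finset.mem_Icc] at hx
    rcases lt_or_ge n x.1 with h1 | h1
    · simp [qFacInv_of_neg hq0 hq1 (show n - x.1 < 0 by omega)]
    · rw [baileyKernel_eq_zero hq0 hq1 m i (by omega), mul_zero, mul_zero]
  have h1 := hs.hasSum.prod_fiberwise fun s =>
    (summable_baileyKernel hq0 hq1 m i c s).hasSum.mul_left (qFacInv q (n - s) * w s)
  have h2 := ((Equiv.prodComm ℤ ℤ).hasSum_iff.2 hs.hasSum).prod_fiberwise fun ρ =>
    ((h ρ).mul_left (c ρ)).congr_fun fun s => by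
      simp only [Function.comp_apply, Equiv.prodComm_apply, Prod.swap]; ring
  rwa [h2.tsum_eq]

/-- Iteration of the Bailey lattice. -/
theorem hasSum_chainTerm {q : ℂ} (hq0 : q ≠ 0) (hq1 : ‖q‖ < 1) (m : ℕ) {r i : ℕ} (hi : i ≤ r)
    (n : ℤ) :
    HasSum (fun s : Fin r → ℤ => chainTerm q m i (Fin.cons n s : Fin (r + 1) → ℤ))
      (∑' ρ, baileyCoeff q m r i ρ * baileyKernel q m i ρ n) := by
  induction r generalizing i n with
  | zero =>
    obtain rfl : i = 0 := by omega
    have h := hasSum_lastFactor hq0 hq1 m n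
    refine (hasSum_unique _).congr_eq (fun _ => rfl) ?_
    simp only [chainTerm, Finset.univ_eq_empty, Finset.prod_empty, one_mul]
    rw [show Fin.last 0 = 0 from rfl, Fin.cons_zero, ← h.tsum_eq]
    simp [baileyCoeff, baileyKernel]
  | succ r ih =>
    -- The exponents -s_j sit on the outermost variables, so peeling off the first one lowers i by
    -- one, or leaves it at 0.
    cases i with
    | zero =>
      refine HasSum.of_chain_fibers hq0 hq1 m 0 n (fun a => ih (Nat.zero_le r) a) ?_
      have h := hasSum_tsum_baileyKernel hq0 hq1 m 0 (baileyCoeff q m r 0) _ _ n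
        (fun ρ => hasSum_baileyKernel_zero hq0 hq1 m ρ n)
      simpa [baileyCoeff_succ_zero hq0, mul_assoc] using h
    | succ i =>
      refine HasSum.of_chain_fibers hq0 hq1 m (i + 1) n
        (fun a => ih (i := i) (by omega) a) ?_
      have h := hasSum_tsum_baileyKernel hq0 hq1 m i (baileyCoeff q m r i) _ _ n
        (fun ρ => hasSum_baileyKernel_succ hq0 hq1 m i ρ n)
      simpa [baileyCoeff_succ_succ hq0, mul_assoc] using h

/-! ### The limit of infinitely long chains -/

/-- Substituting ρ² = 2·ρ(ρ-1)/2 + ρ puts the exponent in triple-product form with base q^(2r+1). -/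
theorem baileyCoeff_mul_pow {q : ℂ} (hq0 : q ≠ 0) (m r i k : ℕ) (ρ : ℤ) :
    baileyCoeff q m r i ρ * (q ^ ((m : ℤ) + 2 * ρ)) ^ k =
      q ^ (m * k) * ((-1) ^ ρ * ((q ^ (2 * r + 1)) ^ (ρ * (ρ - 1) / 2) *
        (q ^ (((m : ℤ) + 1) * r - i + 2 * k)) ^ ρ)) := by
  have h := two_mul_triangle ρ
  have e : q ^ (ρ * (ρ - 1) / 2 + r * ρ ^ 2 + ((r : ℤ) * m - i) * ρ) *
      (q ^ ((m : ℤ) + 2 * ρ)) ^ k = q ^ (m * k) * ((q ^ (2 * r + 1)) ^ (ρ * (ρ - 1) / 2) *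
        (q ^ (((m : ℤ) + 1) * r - i + 2 * k)) ^ ρ) := by
    rw [← zpow_natCast, ← zpow_natCast q (m * k), ← zpow_natCast q (2 * r + 1), ← zpow_mul,
      ← zpow_mul, ← zpow_mul, ← zpow_add₀ hq0, ← zpow_add₀ hq0, ← zpow_add₀ hq0]
    congr 1
    push_cast
    linear_combination (-(r : ℤ)) * h
  rw [baileyCoeff, mul_assoc, e]
  ring

theorem norm_pow_lt_one {q : ℂ} (hq1 : ‖q‖ < 1) (r : ℕ) : ‖q ^ (2 * r + 1)‖ < 1 := by
  rw [norm_pow]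
  exact pow_lt_one₀ (norm_nonneg q) hq1 (by omega)

theorem summable_norm_baileyCoeff_mul_pow {q : ℂ} (hq0 : q ≠ 0) (hq1 : ‖q‖ < 1) (m r i k : ℕ) :
    Summable fun ρ : ℤ => ‖baileyCoeff q m r i ρ * (q ^ ((m : ℤ) + 2 * ρ)) ^ k‖ := by
  refine ((summable_norm_theta (pow_ne_zero (2 * r + 1) hq0) (norm_pow_lt_one hq1 r)
    (zpow_ne_zero (((m : ℤ) + 1) * r - i + 2 * k) hq0)).mul_left ‖q ^ (m * k)‖).congr fun ρ => ?_
  rw [baileyCoeff_mul_pow hq0, norm_mul (q ^ (m * k)) ((-1) ^ ρ * _), norm_mul ((-1 : ℂ) ^ ρ),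
    norm_zpow (-1 : ℂ), norm_neg, norm_one, one_zpow, one_mul]

theorem hasSum_baileyCoeff_mul_pow {q : ℂ} (hq0 : q ≠ 0) (hq1 : ‖q‖ < 1) (m r i k : ℕ) :
    HasSum (fun ρ : ℤ => baileyCoeff q m r i ρ * (q ^ ((m : ℤ) + 2 * ρ)) ^ k)
      (q ^ (m * k) * (qPochInf (q ^ (2 * r + 1)) (q ^ (2 * r + 1)) *
        qPochInf (q ^ (((m : ℤ) + 1) * r - i + 2 * k)) (q ^ (2 * r + 1)) *
        qPochInf (q ^ ((1 - (m : ℤ)) * r + i - 2 * k + 1)) (q ^ (2 * r + 1)))) := by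
  have h := hasSum_tripleProduct (pow_ne_zero (2 * r + 1) hq0) (norm_pow_lt_one hq1 r)
    (zpow_ne_zero (((m : ℤ) + 1) * r - i + 2 * k) hq0)
  have e : q ^ (2 * r + 1) / q ^ (((m : ℤ) + 1) * r - i + 2 * k) =
      q ^ ((1 - (m : ℤ)) * r + i - 2 * k + 1) := by
    rw [← zpow_natCast q (2 * r + 1), ← zpow_sub₀ hq0]
    congr 1
    push_cast
    ring
  rw [e] at h
  exact (h.mul_left (q ^ (m * k))).congr_fun fun ρ => baileyCoeff_mul_pow hq0 m r i k ρ

/-- For k ≥ 1 the factor 1 - q^(n-ρ) is absorbed into 1/(q)_{n-ρ-1}. All dependence on n then lies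
in two uniformly bounded reciprocals, each tending to 1/(q)_∞. -/
theorem baileyCoeff_mul_baileyKernel {q : ℂ} (hq0 : q ≠ 0) (hq1 : ‖q‖ < 1) (m r i : ℕ) (ρ n : ℤ) :
    baileyCoeff q m r i ρ * baileyKernel q m i ρ n =
      ∑ k ∈ Finset.range (i + 1), baileyCoeff q m r i ρ * (q ^ ((m : ℤ) + 2 * ρ)) ^ k *
        (qFacInv q (n + (-ρ - if k = 0 then 0 else 1)) * qFacInv q (n + (m + ρ))) := by
  have h := qFacInv_sub_one hq0 hq1 (n - ρ)
  rw [Finset.sum_range_succ', baileyKernel]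
  simp only [Nat.add_eq_zero_iff, one_ne_zero, and_false, if_false, if_true, pow_zero, mul_one,
    ← Finset.sum_mul, ← Finset.mul_sum, show n + (-ρ - 1) = n - ρ - 1 by ring,
    show n + (-ρ - 0) = n - ρ by ring, show n + (m + ρ) = m + n + ρ by ring, h]
  ring

theorem tendsto_tsum_baileyKernel {q : ℂ} (hq0 : q ≠ 0) (hq1 : ‖q‖ < 1) (m r i : ℕ) :
    Tendsto (fun n : ℕ => ∑' ρ, baileyCoeff q m r i ρ * baileyKernel q m i ρ n) atTop
      (𝓝 ((∑ k ∈ Finset.range (i + 1),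
        q ^ (m * k) * (qPochInf (q ^ (2 * r + 1)) (q ^ (2 * r + 1)) *
          qPochInf (q ^ (((m : ℤ) + 1) * r - i + 2 * k)) (q ^ (2 * r + 1)) *
          qPochInf (q ^ ((1 - (m : ℤ)) * r + i - 2 * k + 1)) (q ^ (2 * r + 1)))) *
        ((qPochInf q q)⁻¹ * (qPochInf q q)⁻¹))) := by
  obtain ⟨C, hC1, hC⟩ := exists_norm_qFacInv_le hq0 hq1
  rw [← ((hasSum_sum fun k _ => hasSum_baileyCoeff_mul_pow hq0 hq1 m r i k).mul_right _).tsum_eq]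
  refine tendsto_tsum_of_dominated_convergence (bound := fun ρ => ∑ k ∈ Finset.range (i + 1),
    ‖baileyCoeff q m r i ρ * (q ^ ((m : ℤ) + 2 * ρ)) ^ k‖ * (C * C))
    (summable_sum fun k _ => (summable_norm_baileyCoeff_mul_pow hq0 hq1 m r i k).mul_right _)
    (fun ρ => ?_) (Eventually.of_forall fun n ρ => ?_)
  · simp_rw [baileyCoeff_mul_baileyKernel hq0 hq1, Finset.sum_mul]
    exact tendsto_finsetSum _ fun k _ =>
      ((tendsto_qFacInv hq0 hq1 _).mul (tendsto_qFacInv hq0 hq1 _)).const_mul _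
  · rw [baileyCoeff_mul_baileyKernel hq0 hq1]
    refine norm_sum_le_of_le _ fun k _ => ?_
    rw [norm_mul, norm_mul (qFacInv _ _)]
    gcongr
    exacts [hC _, hC _]

/-! ### The `m`-version of the Andrews–Gordon identities -/

theorem chainTerm_cons (q : ℂ) (hq0 : q ≠ 0) (m i R : ℕ) (n : ℤ) (s : Fin (R + 1) → ℤ) :
    chainTerm q m i (Fin.cons n s : Fin (R + 2) → ℤ) =
      qFacInv q (n - s 0) * (q ^ sumExponent m (R + 1) i s / sumDenominator q (R + 1) s *
        lastFactor q m (s (Fin.last R))) := by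
  have hE : q ^ sumExponent m (R + 1) i s =
      ∏ j, q ^ (s j ^ 2 + m * s j - if j.val < i then s j else 0) := by
    rw [sumExponent, Finset.sum_filter, Finset.mul_sum, ← Finset.sum_add_distrib,
      ← Finset.sum_sub_distrib]
    generalize (Finset.univ : Finset (Fin (R + 1))) = S
    induction S using Finset.cons_induction with
    | empty => simp
    | cons a S ha ih => rw [Finset.sum_cons, Finset.prod_cons, zpow_add₀ hq0, ih]
  have hD : (sumDenominator q (R + 1) s)⁻¹ =
      ∏ j : Fin R, qFacInv q (s j.castSucc - s j.succ) := by
    rw [sumDenominator, ← Finset.prod_inv_distrib]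
    rfl
  rw [chainTerm, Finset.prod_mul_distrib, Fin.prod_univ_succ, div_eq_mul_inv, hE, hD]
  simp only [Fin.cons_succ, Fin.castSucc_zero, Fin.cons_zero, ← Fin.succ_castSucc, ← Fin.succ_last]
  ring

theorem hasSum_andrewsGordon {q : ℂ} (hq0 : q ≠ 0) (hq1 : ‖q‖ < 1) (m R i : ℕ) (hi : i ≤ R + 1) :
    HasSum (fun s : Fin (R + 1) → ℤ =>
        q ^ sumExponent m (R + 1) i s / sumDenominator q (R + 1) s *
          lastFactor q m (s (Fin.last R)))
      (∑ k ∈ Finset.range (i + 1),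
        q ^ (m * k) *
          (qPochInf (q ^ (2 * (R + 1) + 1)) (q ^ (2 * (R + 1) + 1)) *
            qPochInf (q ^ (((m : ℤ) + 1) * (R + 1 : ℕ) - i + 2 * k)) (q ^ (2 * (R + 1) + 1)) *
            qPochInf (q ^ ((1 - (m : ℤ)) * (R + 1 : ℕ) + i - 2 * k + 1))
              (q ^ (2 * (R + 1) + 1))) /
          qPochInf q q) := by
  obtain ⟨bound, hb, hle⟩ := exists_summable_bound_chainTerm hq0 hq1 m i (R + 1)
  have hne := inv_ne_zero (qPochInf_self_ne_zero hq1)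
  -- The limit of 1/(q)_{n-s_1} supplies one 1/(q)_∞ on the left, which cancels one of the two on
  -- the right.
  rw [← hasSum_mul_left_iff hne]
  refine (hasSum_of_tendsto_dominated hb (fun (n : ℕ) s => hle n s) (fun s => ?_)
    (fun n => hasSum_chainTerm hq0 hq1 m hi n)
    (tendsto_tsum_baileyKernel hq0 hq1 m (R + 1) i)).congr_eq (fun s => rfl) ?_
  · simp_rw [chainTerm_cons q hq0]
    exact (tendsto_qFacInv hq0 hq1 (-s 0)).mul_const _
  · simp_rw [div_eq_mul_inv, ← Finset.sum_mul]
    ring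

/-- The constraints on s are automatic: an ascent makes some `qPoch` factor take its default value
0, hence the quotient is 0, and the q-binomial vanishes when m + 2s_r < 0. -/
theorem summand_support_subset {q : ℂ} (hq0 : q ≠ 0) (hq1 : ‖q‖ < 1) (m R i : ℕ) :
    Function.support (fun s : Fin (R + 1) → ℤ =>
        q ^ sumExponent m (R + 1) i s / sumDenominator q (R + 1) s *
          lastFactor q m (s (Fin.last R))) ⊆ multiIndices m (R + 1) := by
  intro s hs
  rw [Function.mem_support] at hs
  have hlast : -((m / 2 : ℕ) : ℤ) ≤ s (Fin.last R) := by
    by_contra h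
    exact right_ne_zero_of_mul hs (lastFactor_eq_zero q m (by omega))
  have hanti : Antitone s := by
    rw [Fin.antitone_iff_succ_le]
    intro j
    by_contra h
    refine left_ne_zero_of_mul hs (div_eq_zero_iff.2 (Or.inr (Finset.prod_eq_zero
      (Finset.mem_univ j) ?_)))
    rw [qPoch_eq_inv, inv_eq_zero]
    exact qFacInv_of_neg hq0 hq1 (by
      change s j.castSucc - s j.succ < 0
      omega)
  exact ⟨hanti, fun j => hlast.trans (hanti (Fin.le_last j))⟩

theorem theorem1p15 (q : ℂ) (hq0 : q ≠ 0) (hq1 : ‖q‖ < 1) (m r i : ℕ) (hr : 2 ≤ r) (hi : i ≤ r) :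
    HasSum
      (fun s : multiIndices m r =>
        q ^ sumExponent m r i s.1 / sumDenominator q r s.1 *
          lastFactor q m (s.1 ⟨r - 1, by omega⟩))
      (∑ k ∈ Finset.range (i + 1),
        q ^ (m * k) *
          (qPochInf (q ^ (2 * r + 1)) (q ^ (2 * r + 1)) *
            qPochInf (q ^ (((m : ℤ) + 1) * r - i + 2 * k)) (q ^ (2 * r + 1)) *
            qPochInf (q ^ ((1 - (m : ℤ)) * r + i - 2 * k + 1)) (q ^ (2 * r + 1))) /
          qPochInf q q) := by
  obtain ⟨R, rfl⟩ : ∃ R, r = R + 1 := ⟨r - 1, by omega⟩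
  exact (hasSum_subtype_iff_of_support_subset (summand_support_subset hq0 hq1 m R i)).2
    (hasSum_andrewsGordon hq0 hq1 m R i hi)
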